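/- Let $\mathbf{MSL}$ be the category of meet-semilattices with a top element and maps preserving binary meets and top, and let $2=\{0,1\}$ be the two-element semilattice whose meet is the minimum. The dual adjunction $\mathbf{Set}(-,2)\dashv \mathbf{MSL}(-,2)\colon \mathbf{MSL}^{\mathrm{op}}\to\mathbf{Set}$ (where $\mathbf{Set}(X,2)$ carries the pointwise semilattice structure) induces the filter monad $\mathcal{F}$ on $\mathbf{Set}$, with $\mathcal{F}X=\mathbf{MSL}(\mathbf{Set}(X,2),2)$. Let $\mathcal{P}_{\mathrm f}$ be the finite power set monad on $\mathbf{Set}$. For a functor $F\colon \mathbf{A}\to\mathbf{C}$ whose right Kan extension $\mathrm{Ran}_F F$ along itself exists, with counit $\varphi\colon (\mathrm{Ran}_F F)F\to F$, the codensity monad of $F$ is the monad on $\mathbf{C}$ with underlying functor $\mathrm{Ran}_F F$, whose unit and multiplication correspond under the universal property of $\mathrm{Ran}_F F$ to $\mathrm{id}_F$ and to $\varphi\circ(\mathrm{Ran}_F F)\varphi$, respectively. Theorem. For each of the following two functors, the right Kan extension along itself exists and is pointwise (i.e. given by the limits $\lim_{X\to FA}FA$), and the filter monad $\mathcal{F}$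 is isomorphic, as a monad, to its codensity monad: 1. the forgetful functor $U\colon \mathbf{MSL}_{\mathrm f}\to\mathbf{Set}$ from the full subcategory $\mathbf{MSL}_{\mathrm f}\subseteq\mathbf{MSL}$ of finite meet-semilattices with top; 2. the forgetful functor $U_{\mathcal{P}_{\mathrm f}}\colon \mathbf{Kl}_{\mathrm f}(\mathcal{P}_{\mathrm f})\to\mathbf{Set}$ from the full subcategory of the Kleisli category of $\mathcal{P}_{\mathrm f}$ on the finite sets (equivalently, finite sets and relations), which sends $X$ to $\mathcal{P}_{\mathrm f}X$ and a Kleisli morphism $f\colon X\to\mathcal{P}_{\mathrm f}Y$ to $f^{\#}\colon \mathcal{P}_{\mathrm f}X\to\mathcal{P}_{\mathrm f}Y$, $S\mapsto\bigcup_{x\in S}f(x)$. -/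

import Mathlib

universe v v' w w' u

noncomputable section

namespace CodensityFilter

open CategoryTheory CategoryTheory.Functor

section Codensity

variable {A : Type w} [Category.{v} A] {C : Type w'} [Category.{v'} C]

/-- The unit of the codensity monad of `F`, corresponding under the universal property of
`Ran_F F` to `id : F ⟶ F`. -/
def codensityUnit (F : A ⥤ C) [F.HasRightKanExtension F] : 𝟭 C ⟶ F.rightKanExtension F :=
  (F.rightKanExtension F).liftOfIsRightKanExtension (F.rightKanExtensionCounit F) (𝟭 C)
    F.rightUnitor.hom

/-- The multiplication of the codensity monad of `F`, corresponding under the universal property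
of `Ran_F F` to `(Ran_F F) (Ran_F F) F ⟶ (Ran_F F) F ⟶ F`, that is `φ ∘ (Ran_F F) φ` with `φ` the
counit of `Ran_F F`. -/
def codensityMul (F : A ⥤ C) [F.HasRightKanExtension F] :
    F.rightKanExtension F ⋙ F.rightKanExtension F ⟶ F.rightKanExtension F :=
  (F.rightKanExtension F).liftOfIsRightKanExtension (F.rightKanExtensionCounit F)
    (F.rightKanExtension F ⋙ F.rightKanExtension F)
    ((Functor.associator F (F.rightKanExtension F) (F.rightKanExtension F)).inv ≫
      whiskerRight (F.rightKanExtensionCounit F) (F.rightKanExtension F) ≫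
      F.rightKanExtensionCounit F)

theorem codensityUnit_fac (F : A ⥤ C) [F.HasRightKanExtension F] (X : A) :
    (codensityUnit F).app (F.obj X) ≫ (F.rightKanExtensionCounit F).app X = 𝟙 (F.obj X) :=
  (F.rightKanExtension F).liftOfIsRightKanExtension_fac_app (F.rightKanExtensionCounit F) _ _ X

theorem codensityMul_fac (F : A ⥤ C) [F.HasRightKanExtension F] (X : A) :
    (codensityMul F).app (F.obj X) ≫ (F.rightKanExtensionCounit F).app X =
      (F.rightKanExtension F).map ((F.rightKanExtensionCounit F).app X) ≫
        (F.rightKanExtensionCounit F).app X :=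
  ((F.rightKanExtension F).liftOfIsRightKanExtension_fac_app
    (F.rightKanExtensionCounit F) _ _ X).trans (Category.id_comp _)

/-- The codensity monad of `F : A ⥤ C`, for `F` admitting a right Kan extension `Ran_F F` along
itself. -/
def codensityMonad (F : A ⥤ C) [F.HasRightKanExtension F] : Monad C where
  toFunctor := F.rightKanExtension F
  η := codensityUnit F
  μ := codensityMul F
  assoc X := by
    have h : whiskerRight (codensityMul F) (F.rightKanExtension F) ≫ codensityMul F =
        (Functor.associator _ _ _).hom ≫ whiskerLeft (F.rightKanExtension F) (codensityMul F) ≫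
          codensityMul F := by
      apply (F.rightKanExtension F).hom_ext_of_isRightKanExtension (F.rightKanExtensionCounit F)
      ext Y
      have e := (codensityMul F).naturality ((F.rightKanExtensionCounit F).app Y)
      dsimp at e ⊢
      simp only [Category.assoc, Category.id_comp, codensityMul_fac, ← Functor.map_comp_assoc]
      rw [Functor.map_comp_assoc, ← reassoc_of% e, codensityMul_fac]
    simpa using NatTrans.congr_app h X
  left_unit X := by
    have h : whiskerLeft (F.rightKanExtension F) (codensityUnit F) ≫ codensityMul F =
        (Functor.rightUnitor _).hom := by
      apply (F.rightKanExtension F).hom_ext_of_isRightKanExtension (F.rightKanExtensionCounit F)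
      ext Y
      have e := (codensityUnit F).naturality ((F.rightKanExtensionCounit F).app Y)
      dsimp at e ⊢
      simp only [Category.assoc, Category.id_comp, codensityMul_fac]
      rw [← reassoc_of% e, codensityUnit_fac, Category.comp_id]
    simpa using NatTrans.congr_app h X
  right_unit X := by
    have h : whiskerRight (codensityUnit F) (F.rightKanExtension F) ≫ codensityMul F =
        (Functor.leftUnitor _).hom := by
      apply (F.rightKanExtension F).hom_ext_of_isRightKanExtension (F.rightKanExtensionCounit F)
      ext Y
      dsimp
      simp only [Category.assoc, Category.id_comp, codensityMul_fac, ← Functor.map_comp_assoc,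
        codensityUnit_fac]
      exact (congrArg (· ≫ _) ((F.rightKanExtension F).map_id _)).trans (Category.id_comp _)
    simpa using NatTrans.congr_app h X

/-- `T` is the (pointwise) codensity monad of `F`: the right Kan extension of `F` along itself
exists and is given by the pointwise limit formula, and the codensity monad of `F` is isomorphic
to `T` in the category of monads and monad morphisms. -/
def IsCodensityMonadOf (T : Monad C) (F : A ⥤ C) : Prop :=
  ∃ _ : F.HasPointwiseRightKanExtension F, Nonempty (T ≅ codensityMonad F)

end Codensity

section FilterMonad

/-- The contravariant functor `Set(-, 2)` from sets to meet-semilattices with top; the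
semilattice structure on `X → 2` is pointwise, and `2 = Bool` has minimum as its meet. -/
def powerFunctor : Type u ⥤ SemilatInfCat.{u}ᵒᵖ where
  obj X := .op (.of (X → Bool))
  map {X Y} f := Quiver.Hom.op (X := SemilatInfCat.of (Y → Bool)) (Y := SemilatInfCat.of (X → Bool))
    (show InfTopHom (Y → Bool) (X → Bool) from
      { toFun := fun p x => p (f x)
        map_inf' := fun _ _ => rfl
        map_top' := rfl })
  map_id _ := rfl
  map_comp _ _ := rfl

/-- The contravariant functor `MSL(-, 2)` from meet-semilattices with top to sets. -/
def homToTwoFunctor : SemilatInfCat.{u}ᵒᵖ ⥤ Type u where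
  obj M := InfTopHom M.unop Bool
  map {M N} f := TypeCat.ofHom fun (χ : InfTopHom M.unop Bool) =>
    χ.comp (show InfTopHom N.unop M.unop from f.unop)
  map_id _ := rfl
  map_comp _ _ := rfl

/-- The dual adjunction `Set(-, 2) ⊣ MSL(-, 2)`, which exchanges the arguments of a function of
two variables. -/
def filterAdjunction : powerFunctor.{u} ⊣ homToTwoFunctor.{u} :=
  Adjunction.mkOfHomEquiv
    { homEquiv X M :=
        { toFun g := TypeCat.ofHom fun x =>
            show InfTopHom M.unop Bool from
              { toFun := fun m => (show InfTopHom M.unop (X → Bool) from g.unop) m x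
                map_inf' := fun a b =>
                  congrFun (map_inf (show InfTopHom M.unop (X → Bool) from g.unop) a b) x
                map_top' := congrFun (map_top (show InfTopHom M.unop (X → Bool) from g.unop)) x }
          invFun h := Quiver.Hom.op (X := M.unop) (Y := SemilatInfCat.of (X → Bool))
            (show InfTopHom M.unop (X → Bool) from
              { toFun := fun m x => (show InfTopHom M.unop Bool from h x) m
                map_inf' := fun a b => funext fun x =>
                  map_inf (show InfTopHom M.unop Bool from h x) a b
                map_top' := funext fun x => map_top (show InfTopHom M.unop Bool from h x) })
          left_inv _ := rfl
          right_inv _ := rfl }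
      homEquiv_naturality_left_symm := fun _ _ => rfl
      homEquiv_naturality_right := fun _ _ => rfl }

/-- The filter monad `X ↦ MSL(Set(X, 2), 2)` on `Set`, induced by the dual adjunction. -/
def filterMonad : Monad (Type u) := filterAdjunction.toMonad

end FilterMonad

section Functors

/-- The category `MSL_f` of finite meet-semilattices with top. -/
abbrev FinMSL : Type (u + 1) :=
  ObjectProperty.FullSubcategory fun M : SemilatInfCat.{u} => Finite M

/-- The forgetful functor `U : MSL_f ⥤ Set`. -/
def forgetFinMSL : FinMSL.{u} ⥤ Type u :=
  ObjectProperty.ι _ ⋙ forget SemilatInfCat.{u}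

open Classical in
/-- The finite power set monad `P_f` on `Set`. -/
def finPowerMonad : Monad (Type u) := ofTypeMonad Finset.{u}

/-- The full subcategory `Kl_f(P_f)` of the Kleisli category of `P_f` on the finite sets. -/
abbrev FinKleisli : Type (u + 1) :=
  ObjectProperty.FullSubcategory fun X : Kleisli finPowerMonad.{u} => Finite X.of

/-- The forgetful functor `U_{P_f} : Kl_f(P_f) ⥤ Set`, sending `X` to `P_f X` and a Kleisli
morphism `f : X → P_f Y` to its extension `P_f X → P_f Y`. -/
def forgetFinKleisli : FinKleisli.{u} ⥤ Type u :=
  ObjectProperty.ι _ ⋙ Kleisli.Adjunction.fromKleisli finPowerMonad.{u}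

end Functors

end CodensityFilter

end

noncomputable section

namespace CodensityFilter

open CategoryTheory CategoryTheory.Functor

/-! An element of the limit of `F.obj Y` over all maps `X → F.obj Y` is a family of points
compatible with every homomorphism, because `F` is full onto homomorphisms. Homomorphisms to 2
separate points, so the family is determined by its values at the maps `X → 2`. These values form a
function `(X → 2) → 2`, and compatibility with homomorphisms out of 2 × 2 makes it preserve binary
meets: it is a filter (`exists_filter_of_compatible`). Conversely, a filter on a finite semilattice
`M` has a smallest member. The meet of that member is a point `a` with `χ a = φ χ` for every
homomorphism `χ : M → 2` (`apply_limitPoint`). This equation determines `a`, and it reduces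
naturality and the algebra laws of the action to evaluation at `χ`. Both functors meet these
conditions. For relations, finite power sets are ordered by reverse inclusion, so that union is the
meet. -/

/-- A monad `T` whose underlying functor is a pointwise right Kan extension of `F` along itself,
with counit `α` making every `F.obj X` an algebra for `T`, is the codensity monad of `F`. -/
theorem isCodensityMonadOf_of_isPointwiseRightKanExtension
    {A : Type w} [Category.{v} A] {C : Type w'} [Category.{v'} C] (T : Monad C) (F : A ⥤ C)
    (α : F ⋙ T.toFunctor ⟶ F)
    (hα : (RightExtension.mk T.toFunctor α).IsPointwiseRightKanExtension)
    (unit : ∀ X, T.η.app (F.obj X) ≫ α.app X = 𝟙 (F.obj X))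
    (mul : ∀ X, T.μ.app (F.obj X) ≫ α.app X = T.map (α.app X) ≫ α.app X) :
    IsCodensityMonadOf T F := by
  have hF : F.HasPointwiseRightKanExtension F := hα.hasPointwiseRightKanExtension
  refine ⟨hF, ?_⟩
  have : T.toFunctor.IsRightKanExtension α := hα.isRightKanExtension
  let e : T.toFunctor ≅ F.rightKanExtension F :=
    rightKanExtensionUnique _ α _ (F.rightKanExtensionCounit F)
  have he (X : A) : e.hom.app (F.obj X) ≫ (F.rightKanExtensionCounit F).app X = α.app X := by
    simp [e, rightKanExtensionUnique]
  refine ⟨MonadIso.mk e (fun X => ?_) (fun X => ?_)⟩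
  -- A natural transformation into the Kan extension is determined by its composite with the counit,
  -- so both monad laws need checking only at the objects `F.obj Y`, where they become `unit` and
  -- `mul`.
  · have h : T.η ≫ e.hom = codensityUnit F := by
      apply (F.rightKanExtension F).hom_ext_of_isRightKanExtension (F.rightKanExtensionCounit F)
      ext Y
      dsimp
      rw [Category.assoc, he, codensityUnit_fac, unit]
    exact NatTrans.congr_app h X
  · have h : T.μ ≫ e.hom = (whiskerRight e.hom T.toFunctor ≫
        whiskerLeft (F.rightKanExtension F) e.hom) ≫ codensityMul F := by
      apply (F.rightKanExtension F).hom_ext_of_isRightKanExtension (F.rightKanExtensionCounit F)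
      ext Y
      have n := e.hom.naturality ((F.rightKanExtensionCounit F).app Y)
      dsimp at n ⊢
      simp only [Category.assoc, he, codensityMul_fac, mul]
      rw [← reassoc_of% n, he, ← Functor.map_comp_assoc, he]
    exact NatTrans.congr_app h X

section LimitPoint

/-- The indicator function of the up-set generated by `m`, as a homomorphism to `2`. -/
def upperIndicator {M : Type*} [SemilatticeInf M] [OrderTop M] (m : M) : InfTopHom M Bool :=
  open Classical in
  { toFun := fun x => decide (m ≤ x)
    map_inf' := fun a b => (Bool.decide_congr le_inf_iff).trans (Bool.decide_and _ _)
    map_top' := by simp }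

/-- Homomorphisms to `2` separate the points of a meet-semilattice. -/
theorem eq_of_forall_infTopHom {M : Type*} [SemilatticeInf M] [OrderTop M] {a b : M}
    (h : ∀ χ : InfTopHom M Bool, χ a = χ b) : a = b := by
  have key (m x : M) : upperIndicator m x = true ↔ m ≤ x := by simp [upperIndicator]
  exact le_antisymm ((key a b).1 (h _ ▸ (key a a).2 le_rfl))
    ((key b a).1 (h _ ▸ (key b b).2 le_rfl))

/-- By finiteness the meet `p` of all members of `φ` is again a member, so `φ χ` holds iff `p ≤ χ`.
As `χ` preserves finite meets, `p ≤ χ` says exactly that `χ` is true at the meet of the elements of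
`p`. -/
theorem exists_limitPoint {M : Type*} [SemilatticeInf M] [OrderTop M] [Finite M]
    (φ : InfTopHom (M → Bool) Bool) : ∃ a : M, ∀ χ : InfTopHom M Bool, χ a = φ χ := by
  classical
  have := Fintype.ofFinite M
  let p : M → Bool := (Finset.univ.filter fun q => φ q = true).inf id
  have hp : φ p = true := by
    rw [map_finset_inf]
    exact (Finset.inf_eq_top_iff _ _).2 fun q hq => (Finset.mem_filter.1 hq).2
  refine ⟨(Finset.univ.filter fun m => p m = true).inf id, fun χ => ?_⟩
  rw [Bool.eq_iff_iff, map_finset_inf]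
  refine (Finset.inf_eq_top_iff (f := χ ∘ id) _).trans ⟨fun h => ?_, fun h m hm => ?_⟩
  · have hle : p ≤ χ := fun m hm => h m (Finset.mem_filter.2 ⟨Finset.mem_univ _, hm⟩)
    exact OrderHomClass.mono φ hle hp
  · have hle : p ≤ χ := Finset.inf_le (f := id) (Finset.mem_filter.2 ⟨Finset.mem_univ _, h⟩)
    exact hle m (Finset.mem_filter.1 hm).2

/-- The meet of the smallest member of a filter `φ` on a finite meet-semilattice. -/
def limitPoint {M : Type*} [SemilatticeInf M] [OrderTop M] [Finite M]
    (φ : InfTopHom (M → Bool) Bool) : M :=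
  (exists_limitPoint φ).choose

theorem apply_limitPoint {M : Type*} [SemilatticeInf M] [OrderTop M] [Finite M]
    (φ : InfTopHom (M → Bool) Bool) (χ : InfTopHom M Bool) : χ (limitPoint φ) = φ χ :=
  (exists_limitPoint φ).choose_spec χ

end LimitPoint

section Criterion

variable {A : Type w} [Category.{v} A] (F : A ⥤ Type u) [∀ X, SemilatticeInf (F.obj X)]
  [∀ X, OrderTop (F.obj X)]

/-- A family of elements indexed by the maps from a set `X` to the values of `F`, compatible with
all homomorphisms, is given by evaluation at a filter on `X`. -/
theorem exists_filter_of_compatible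
    {B D : A} (eB : F.obj B ≃o Bool) (eD : F.obj D ≃o Bool × Bool) {X : Type*}
    (θ : ∀ Y, (X → F.obj Y) → F.obj Y)
    (hθ : ∀ {Y Z : A} (g : InfTopHom (F.obj Y) (F.obj Z)) (p : X → F.obj Y),
      g (θ Y p) = θ Z (g ∘ p)) :
    ∃ φ : InfTopHom (X → Bool) Bool,
      ∀ (Y : A) (p : X → F.obj Y) (χ : InfTopHom (F.obj Y) Bool), χ (θ Y p) = φ (χ ∘ p) := by
  let toB : InfTopHom Bool (F.obj B) := (eB.symm : InfTopHom Bool (F.obj B))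
  -- Compatibility with `χ`, regarded as a homomorphism into `F.obj B`, moves every value to the
  -- copy of 2.
  have heval (Y : A) (p : X → F.obj Y) (χ : InfTopHom (F.obj Y) Bool) :
      χ (θ Y p) = eB (θ B (eB.symm ∘ χ ∘ p)) := by
    have h : eB.symm (χ (θ Y p)) = θ B (eB.symm ∘ χ ∘ p) := hθ (toB.comp χ) p
    rw [← h, OrderIso.apply_symm_apply]
  refine ⟨⟨⟨fun p => eB (θ B (eB.symm ∘ p)), fun p q => ?_⟩, ?_⟩, heval⟩
  -- Both projections of 2 × 2 and their meet are homomorphisms. Evaluating all three at the single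
  -- point `θ D r`, with `r` the pairing of `p` and `q`, shows that meets are preserved.
  · let d : InfTopHom (F.obj D) (Bool × Bool) := (eD : InfTopHom (F.obj D) (Bool × Bool))
    let r : X → F.obj D := fun x => eD.symm (p x, q x)
    let χ₁ : InfTopHom (F.obj D) Bool := ⟨⟨fun z => (d z).1, fun a b => by simp⟩, by simp⟩
    let χ₂ : InfTopHom (F.obj D) Bool := ⟨⟨fun z => (d z).2, fun a b => by simp⟩, by simp⟩
    have h₁ : χ₁ ∘ r = p := funext fun x => congrArg Prod.fst (eD.apply_symm_apply (p x, q x))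
    have h₂ : χ₂ ∘ r = q := funext fun x => congrArg Prod.snd (eD.apply_symm_apply (p x, q x))
    have h₁₂ : (χ₁ ⊓ χ₂ : InfTopHom (F.obj D) Bool) ∘ r = p ⊓ q := by
      rw [← h₁, ← h₂]; rfl
    have e₁ := heval D r χ₁
    have e₂ := heval D r χ₂
    have e₁₂ := heval D r (χ₁ ⊓ χ₂)
    rw [h₁] at e₁
    rw [h₂] at e₂
    rw [h₁₂] at e₁₂
    rw [← e₁, ← e₂, ← e₁₂]
    rfl
  -- The constant homomorphism `⊤` shows that the top is preserved.
  · exact (heval B (fun _ => ⊤) ⊤).symm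

variable [∀ X, Finite (F.obj X)]

/-- The canonical action of the filter monad on the values of a functor to finite
meet-semilattices. -/
def limitPointTransformation
    (hmap : ∀ {X Y : A} (f : X ⟶ Y), ∃ g : InfTopHom (F.obj X) (F.obj Y), ∀ x, F.map f x = g x) :
    F ⋙ filterMonad.{u}.toFunctor ⟶ F where
  app X := TypeCat.ofHom fun φ : InfTopHom (F.obj X → Bool) Bool => limitPoint φ
  naturality X Y f := by
    obtain ⟨g, hg⟩ := hmap f
    ext φ
    refine eq_of_forall_infTopHom fun χ => ?_
    change InfTopHom (F.obj X → Bool) Bool at φ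
    refine (apply_limitPoint _ χ).trans ?_
    change φ (fun x => χ (F.map f x)) = χ (F.map f (limitPoint φ))
    rw [hg]
    refine Eq.trans ?_ (apply_limitPoint φ (χ.comp g)).symm
    congr 1
    funext x
    exact congrArg χ (hg x)

/-- Let `F` be a functor to finite meet-semilattices that is full onto homomorphisms and has the
semilattices `2` and `2 × 2` among its values. Then the filter monad is the codensity monad
of `F`. -/
theorem isCodensityMonadOf_filterMonad
    (hmap : ∀ {X Y : A} (f : X ⟶ Y), ∃ g : InfTopHom (F.obj X) (F.obj Y), ∀ x, F.map f x = g x)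
    (hfull : ∀ {X Y : A} (g : InfTopHom (F.obj X) (F.obj Y)), ∃ f : X ⟶ Y, ∀ x, F.map f x = g x)
    {B D : A} (eB : F.obj B ≃o Bool) (eD : F.obj D ≃o Bool × Bool) :
    IsCodensityMonadOf filterMonad.{u} F := by
  refine isCodensityMonadOf_of_isPointwiseRightKanExtension _ F
    (limitPointTransformation F hmap) (fun X => ?_) (fun X => ?_) (fun X => ?_)
  · have hfilter (s : Limits.Cone (StructuredArrow.proj X F ⋙ F)) (t : s.pt) :=
      exists_filter_of_compatible F eB eD (X := X)
        (fun Y p => s.π.app (StructuredArrow.mk (Y := Y) (TypeCat.ofHom p)) t)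
        (fun {Y Z} g p => by
          obtain ⟨f, hf⟩ := hfull g
          refine (hf _).symm.trans ?_
          rw [show g ∘ p = F.map f ∘ p from funext fun x => (hf _).symm]
          -- Postcomposition with `f` is a morphism of the comma category, so this is the cone
          -- condition.
          exact ConcreteCategory.congr_hom (s.w (StructuredArrow.homMk f :
            StructuredArrow.mk (TypeCat.ofHom p) ⟶
              StructuredArrow.mk (TypeCat.ofHom (F.map f ∘ p)))) t)
    refine Limits.IsLimit.mk (fun s => TypeCat.ofHom fun t => (hfilter s t).choose) ?_ ?_
    · intro s j
      ext t
      refine eq_of_forall_infTopHom fun χ => (apply_limitPoint _ χ).trans ?_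
      exact ((hfilter s t).choose_spec j.right j.hom χ).symm
    · intro s m hm
      ext t
      -- A filter is recovered from its limit points along the maps `X → F.obj B`, which gives
      -- uniqueness.
      let toB : InfTopHom (F.obj B) Bool := (eB : InfTopHom (F.obj B) Bool)
      refine InfTopHom.ext fun p => ?_
      let q : X → F.obj B := eB.symm ∘ p
      have hq : toB ∘ q = p := funext fun x => eB.apply_symm_apply (p x)
      have h₁ := (hfilter s t).choose_spec B q toB
      rw [hq] at h₁
      refine Eq.trans ?_ h₁
      rw [← hm (StructuredArrow.mk (TypeCat.ofHom q))]
      refine Eq.trans ?_ (apply_limitPoint _ toB).symm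
      exact DFunLike.congr_arg (F := InfTopHom (X → Bool) Bool) (m t) hq.symm
  · ext x
    exact eq_of_forall_infTopHom fun χ => apply_limitPoint _ χ
  · ext Φ
    refine eq_of_forall_infTopHom fun χ => (apply_limitPoint _ χ).trans ?_
    refine Eq.trans ?_ (apply_limitPoint _ χ).symm
    change InfTopHom (InfTopHom (F.obj X → Bool) Bool → Bool) Bool at Φ
    -- After evaluation at `χ`, the two sides differ only by the defining property of `limitPoint`
    -- under `Φ`.
    change Φ (fun φ => φ χ) = Φ (fun φ => χ (limitPoint φ))
    simp only [apply_limitPoint]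

end Criterion

section FinMSL

instance (M : FinMSL.{u}) : SemilatticeInf (forgetFinMSL.obj M) :=
  inferInstanceAs (SemilatticeInf M.obj)

instance (M : FinMSL.{u}) : OrderTop (forgetFinMSL.obj M) :=
  inferInstanceAs (OrderTop M.obj)

instance (M : FinMSL.{u}) : Finite (forgetFinMSL.obj M) := M.property

/-- A preordered type is order isomorphic to its lift to another universe. -/
def uliftOrderIso (α : Type*) [Preorder α] : ULift.{u} α ≃o α where
  toEquiv := Equiv.ulift
  map_rel_iff' := Iff.rfl

theorem isCodensityMonadOf_forgetFinMSL :
    IsCodensityMonadOf filterMonad.{u} forgetFinMSL.{u} :=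
  isCodensityMonadOf_filterMonad forgetFinMSL
    (fun f => ⟨f.hom, fun _ => rfl⟩)
    (fun g => ⟨ObjectProperty.homMk g, fun _ => rfl⟩)
    (B := ⟨.of (ULift Bool), inferInstanceAs (Finite (ULift Bool))⟩)
    (D := ⟨.of (ULift (Bool × Bool)), inferInstanceAs (Finite (ULift (Bool × Bool)))⟩)
    (uliftOrderIso Bool) (uliftOrderIso (Bool × Bool))

end FinMSL

section FinKleisli

/-- The values of `forgetFinKleisli` are meet-semilattices under reverse inclusion. -/
instance (X : FinKleisli.{u}) : SemilatticeInf (forgetFinKleisli.obj X) :=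
  open Classical in inferInstanceAs (SemilatticeInf (Finset X.obj.of)ᵒᵈ)

instance (X : FinKleisli.{u}) : OrderTop (forgetFinKleisli.obj X) :=
  inferInstanceAs (OrderTop (Finset X.obj.of)ᵒᵈ)

instance (X : FinKleisli.{u}) : Finite (forgetFinKleisli.obj X) :=
  have : Finite X.obj.of := X.property
  inferInstanceAs (Finite (Finset X.obj.of))

/-- Complementation identifies the subsets of a finite set, under reverse inclusion, with its
`Bool`-valued functions. -/
def finsetDualOrderIso {X ι : Type*} [Fintype X] (e : X ≃ ι) : (Finset X)ᵒᵈ ≃o (ι → Bool) :=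
  open Classical in
  { toFun := fun S i => decide (e.symm i ∉ OrderDual.ofDual S)
    invFun := fun p => OrderDual.toDual (Finset.univ.filter fun x => p (e x) = false)
    left_inv := fun S => by
      refine OrderDual.ofDual.injective (Finset.ext fun x => ?_)
      simp
    right_inv := fun p => by
      funext i
      simp
    map_rel_iff' := fun {S T} => by
      rw [← OrderDual.ofDual_le_ofDual]
      refine ⟨fun h x hx => ?_, fun h i => ?_⟩
      · have := h (e x)
        by_contra hS
        simp_all [Bool.le_iff_imp]
      · have := @h (e.symm i)
        simp only [Equiv.coe_fn_mk, Bool.le_iff_imp, decide_eq_true_eq]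
        exact fun hS hT => hS (this hT) }

open Classical in
/-- The extension of a relation to sets of points, as a homomorphism for reverse inclusion. -/
def relationImageHom {X Y : Type*} (f : X → Finset Y) : InfTopHom (Finset X)ᵒᵈ (Finset Y)ᵒᵈ where
  toFun S := OrderDual.toDual ((OrderDual.ofDual S).sup f)
  map_inf' S T := congrArg OrderDual.toDual
    (Finset.sup_union (s₁ := OrderDual.ofDual S) (s₂ := OrderDual.ofDual T))
  map_top' := rfl

-- Every finite set is a finite union of singletons, and unions are the meets for reverse inclusion.
-- Hence every homomorphism comes from a relation, which is the fullness required of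
-- `forgetFinKleisli`.
open Classical in
theorem relationImageHom_singleton {X Y : Type*} (g : InfTopHom (Finset X)ᵒᵈ (Finset Y)ᵒᵈ) :
    relationImageHom (fun x => OrderDual.ofDual (g (OrderDual.toDual {x}))) = g := by
  refine InfTopHom.ext fun S => ?_
  induction S using OrderDual.rec with | _ S => ?_
  induction S using Finset.induction_on with
  | empty => exact (map_top g).symm
  | insert x S _ ih =>
    have h : OrderDual.toDual (insert x S) = OrderDual.toDual {x} ⊓ OrderDual.toDual S := rfl
    rw [h, map_inf, map_inf, ih]
    congr 1
    exact congrArg OrderDual.toDual Finset.sup_singleton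

/-- The object of `FinKleisli` given by a finite set. -/
def FinKleisli.of (X : Type u) [Finite X] : FinKleisli.{u} := ⟨.mk _ X, ‹Finite X›⟩

/-- The Kleisli extension takes the image under `f` and then the union; `Finset.sup_image` merges
the two into one supremum. -/
theorem forgetFinKleisli_map_apply {X Y : FinKleisli.{u}} (f : X.obj.of → Finset Y.obj.of)
    (S : Finset X.obj.of) :
    forgetFinKleisli.map (ObjectProperty.homMk ⟨TypeCat.ofHom f⟩ : X ⟶ Y) S =
      relationImageHom f (OrderDual.toDual S) :=
  open Classical in @Finset.sup_image _ _ _ _ _ (fun a b => Classical.propDecidable (a = b)) S f id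

theorem isCodensityMonadOf_forgetFinKleisli :
    IsCodensityMonadOf filterMonad.{u} forgetFinKleisli.{u} :=
  isCodensityMonadOf_filterMonad forgetFinKleisli
    (fun f => ⟨relationImageHom fun x => f.hom.of x, fun S => forgetFinKleisli_map_apply _ S⟩)
    (fun {X _} g => ⟨ObjectProperty.homMk ⟨TypeCat.ofHom fun x => g ({x} : Finset X.obj.of)⟩,
      fun S => (forgetFinKleisli_map_apply _ S).trans
        (DFunLike.congr_fun (relationImageHom_singleton g) S)⟩)
    -- The power sets of one and two points are 2 and 2 × 2, up to complementation.
    (B := .of (ULift (Fin 1))) (D := .of (ULift (Fin 2)))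
    ((finsetDualOrderIso Equiv.ulift).trans (OrderIso.funUnique (Fin 1) Bool))
    ((finsetDualOrderIso Equiv.ulift).trans (OrderIso.finTwoArrowIso Bool))

end FinKleisli

end CodensityFilter

end

theorem mainTheorem3 :
    CodensityFilter.IsCodensityMonadOf CodensityFilter.filterMonad.{u}
        CodensityFilter.forgetFinMSL.{u} ∧
      CodensityFilter.IsCodensityMonadOf CodensityFilter.filterMonad.{u}
        CodensityFilter.forgetFinKleisli.{u} := by
  exact ⟨CodensityFilter.isCodensityMonadOf_forgetFinMSL,
    CodensityFilter.isCodensityMonadOf_forgetFinKleisli⟩
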